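/- Let $n\ge 1$ and $1\le k\le n$, and let $A,B$ be $n\times n$ complex matrices. Let $s_1(A)\ge s_2(A)\ge\cdots\ge s_n(A)\ge 0$ be the singular values of $A$, counted with multiplicity, and let $\|A\|_{(k)}=s_1(A)+\cdots+s_k(A)$ be the Ky Fan $k$-norm. Say that $A$ is (Birkhoff–James) orthogonal to $B$ in $\|\cdot\|_{(k)}$ if $\|A+\lambda B\|_{(k)}\ge\|A\|_{(k)}$ for all $\lambda\in\mathbb C$. Let $A=U|A|$ be a polar decomposition of $A$, where $U$ is unitary and $|A|=(A^*A)^{1/2}$. If there exist $k$ orthonormal vectors $u_1,\dots,u_k\in\mathbb C^n$ such that $$|A|u_i=s_i(A)u_i\quad(1\le i\le k)\qquad\text{and}\qquad \sum_{i=1}^k\langle u_i,U^*Bu_i\rangle=0,$$ then $A$ is orthogonal to $B$ in $\|\cdot\|_{(k)}$. Conversely, if $s_k(A)>0$ and $A$ is orthogonal to $B$ in $\|\cdot\|_{(k)}$, then there exist $k$ orthonormal vectors $u_1,\dots,u_k\in\mathbb C^n$ with these two properties. -/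

import Mathlib

open scoped MatrixOrder

/-- The singular values of a square complex matrix in decreasing order with multiplicity,
indexed from `0`: `singVal A i` is the `(i + 1)`-st largest singular value of `A`. -/
noncomputable def singVal {n : ℕ} (A : Matrix (Fin n) (Fin n) ℂ) (i : ℕ) : ℝ :=
  (Matrix.toEuclideanLin A).singularValues i

/-- The Ky Fan `k`-norm: the sum of the `k` largest singular values. -/
noncomputable def kyFanNorm {n : ℕ} (k : ℕ) (A : Matrix (Fin n) (Fin n) ℂ) : ℝ :=
  ∑ i ∈ Finset.range k, singVal A i

/-- Birkhoff-James orthogonality of `A` to `B` with respect to `N`. -/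
def BJOrthogonal {n : ℕ} (N : Matrix (Fin n) (Fin n) ℂ → ℝ)
    (A B : Matrix (Fin n) (Fin n) ℂ) : Prop :=
  ∀ c : ℂ, N A ≤ N (A + c • B)

/-- `A = U |A|` is a polar decomposition of the square matrix `A`: `U` is unitary and
`|A| = (A^* A)^{1/2}`. -/
def IsPolarDecomposition {n : ℕ} (A U : Matrix (Fin n) (Fin n) ℂ) : Prop :=
  U ∈ Matrix.unitaryGroup (Fin n) ℂ ∧ A = U * CFC.abs A

/-! The Ky Fan norm of `X` is the maximum of `Re ∑ ⟪v i, X (u i)⟫` over orthonormal `k`-families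
`u`, `v`. For sufficiency, test `A + c • B` on the pair `u`, `U u`: the `B` term vanishes and the
value is the norm of `A`.

For necessity, perturb by `-t z B` with `t → 0⁺`. Compactness yields, for each `z`, a pair extremal
for `A` with `Re (z ∑ ⟪v i, B (u i)⟫) ≤ 0`. As `s_k > 0`, equality in the variational bound
(`of_re_sum_inner_eq`) forces `v = U u` and makes `u` maximal for `|A|`. So the set of values `∑ ⟪u
i, U* B (u i)⟫` over maximal `u` meets every closed half-plane through `0`. It is compact, and
convex by `convex_image_sum_inner`, hence contains `0`. Finally the span of a maximal family has an
orthonormal basis of top eigenvectors of `|A|`, and this change of basis preserves the trace of the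
compression. -/

/-! ### Singular bases and orthonormal bases of subspaces -/

/-- Pairwise orthogonal vectors are multiples of the members of an orthonormal basis. -/
theorem exists_orthonormalBasis_of_pairwise_orthogonal {W : Type*} [NormedAddCommGroup W]
    [InnerProductSpace ℂ W] [FiniteDimensional ℂ W] {k : ℕ} (hW : Module.finrank ℂ W = k)
    (f : Fin k → W) (hf : ∀ i j, i ≠ j → inner ℂ (f i) (f j) = 0) :
    ∃ b : OrthonormalBasis (Fin k) ℂ W, ∀ i, f i = (‖f i‖ : ℂ) • b i := by
  have ho : Orthonormal ℂ (({i | f i ≠ 0} : Set (Fin k)).domRestrict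
      fun i => ((‖f i‖ : ℂ)⁻¹) • f i) := by
    constructor
    · rintro ⟨i, hi⟩
      have : ‖f i‖ ≠ 0 := norm_ne_zero_iff.mpr hi
      simp [Set.domRestrict, norm_smul, this]
    · rintro ⟨i, hi⟩ ⟨j, hj⟩ hij
      have : i ≠ j := fun h => hij (by simpa using h)
      simp [Set.domRestrict, inner_smul_left, inner_smul_right, hf i j this]
  obtain ⟨b, hb⟩ := ho.exists_orthonormalBasis_extension_of_card_eq (by simp [hW])
  refine ⟨b, fun i => ?_⟩
  by_cases hi : f i = 0
  · simp [hi]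
  · have : (‖f i‖ : ℂ) ≠ 0 := by exact_mod_cast norm_ne_zero_iff.mpr hi
    rw [hb i hi, smul_smul, mul_inv_cancel₀ this, one_smul]

/-- Singular value decomposition of a linear map between spaces of equal finite dimension. -/
theorem LinearMap.exists_singularValues_basis {V W : Type*} [NormedAddCommGroup V]
    [InnerProductSpace ℂ V] [FiniteDimensional ℂ V] [NormedAddCommGroup W]
    [InnerProductSpace ℂ W] [FiniteDimensional ℂ W] {k : ℕ} (T : V →ₗ[ℂ] W)
    (hV : Module.finrank ℂ V = k) (hW : Module.finrank ℂ W = k) :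
    ∃ (x : OrthonormalBasis (Fin k) ℂ V) (y : OrthonormalBasis (Fin k) ℂ W),
      ∀ i : Fin k, T (x i) = (T.singularValues i : ℂ) • y i := by
  set x := T.isSymmetric_adjoint_comp_self.eigenvectorBasis hV with hx
  have hin : ∀ i j, inner ℂ (T (x i)) (T (x j)) =
      ((T.singularValues j : ℂ) ^ 2) * inner ℂ (x i) (x j) := by
    intro i j
    have h := T.isSymmetric_adjoint_comp_self.apply_eigenvectorBasis hV j
    rw [← T.sq_singularValues_fin hV j] at h
    rw [← LinearMap.adjoint_inner_right, ← LinearMap.comp_apply, hx, h, inner_smul_right]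
    simp
  obtain ⟨y, hy⟩ := exists_orthonormalBasis_of_pairwise_orthogonal hW (fun i => T (x i)) (by
    intro i j hij
    rw [hin, x.inner_eq_zero hij, mul_zero])
  refine ⟨x, y, fun i => ?_⟩
  rw [hy i]
  have h := hin i i
  rw [inner_self_eq_norm_sq_to_K, inner_self_eq_norm_sq_to_K, x.norm_eq_one] at h
  have h' : ‖T (x i)‖ ^ 2 = T.singularValues i ^ 2 := by
    have : ((‖T (x i)‖ ^ 2 : ℝ) : ℂ) = ((T.singularValues i ^ 2 : ℝ) : ℂ) := by
      push_cast
      simpa using h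
    exact_mod_cast this
  rw [(sq_eq_sq₀ (norm_nonneg _) (T.singularValues_nonneg i)).mp h']

/-- An orthonormal family, viewed as an orthonormal basis of its span. -/
theorem Orthonormal.exists_orthonormalBasis_span {E : Type*} [NormedAddCommGroup E]
    [InnerProductSpace ℂ E] {k : ℕ} {u : Fin k → E} (hu : Orthonormal ℂ u) :
    ∃ b : OrthonormalBasis (Fin k) ℂ (Submodule.span ℂ (Set.range u)), ∀ i, (b i : E) = u i := by
  have ho : Orthonormal ℂ ((Set.univ : Set (Fin k)).domRestrict fun i =>
      (⟨u i, Submodule.subset_span ⟨i, rfl⟩⟩ : Submodule.span ℂ (Set.range u))) := by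
    constructor
    · rintro ⟨i, -⟩
      exact hu.1 i
    · rintro ⟨i, hi⟩ ⟨j, hj⟩ hij
      exact hu.2 (i := i) (j := j) fun h => hij (by simpa using h)
  have : FiniteDimensional ℂ (Submodule.span ℂ (Set.range u)) :=
    FiniteDimensional.span_of_finite ℂ (Set.finite_range u)
  obtain ⟨b, hb⟩ := ho.exists_orthonormalBasis_extension_of_card_eq (by
    rw [finrank_span_eq_card hu.linearIndependent])
  exact ⟨b, fun i => by rw [hb i trivial]⟩

theorem OrthonormalBasis.orthonormal_coe {E : Type*} [NormedAddCommGroup E]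
    [InnerProductSpace ℂ E] {k : ℕ} {M : Submodule ℂ E} (b : OrthonormalBasis (Fin k) ℂ M) :
    Orthonormal ℂ fun i => (b i : E) :=
  ⟨fun i => b.orthonormal.1 i, fun _ _ hij => b.orthonormal.2 hij⟩

/-- The trace of the compression to a subspace does not depend on the orthonormal basis. -/
theorem OrthonormalBasis.sum_inner_coe_eq {E : Type*} [NormedAddCommGroup E]
    [InnerProductSpace ℂ E] [FiniteDimensional ℂ E] {k : ℕ} {M : Submodule ℂ E}
    (b b' : OrthonormalBasis (Fin k) ℂ M) (T : E →ₗ[ℂ] E) :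
    ∑ i, inner ℂ (b i : E) (T (b i)) = ∑ i, inner ℂ (b' i : E) (T (b' i)) := by
  set S : M →ₗ[ℂ] M := M.orthogonalProjectionOnto.toLinearMap ∘ₗ T ∘ₗ M.subtype with hS
  have key : ∀ c : OrthonormalBasis (Fin k) ℂ M,
      ∑ i, inner ℂ (c i : E) (T (c i)) = LinearMap.trace ℂ M S := by
    intro c
    rw [LinearMap.trace_eq_sum_inner S c]
    refine Finset.sum_congr rfl fun i _ => ?_
    simp [hS]
  rw [key, key]

/-! ### Convexity of numerical ranges -/

/-- Toeplitz-Hausdorff in normalized form. -/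
theorem exists_inner_eq_of_one_zero {E : Type*} [NormedAddCommGroup E] [InnerProductSpace ℂ E]
    (T : E →ₗ[ℂ] E) {x y : E} (hx : ‖x‖ = 1) (hy : ‖y‖ = 1) (hTx : inner ℂ x (T x) = 1)
    (hTy : inner ℂ y (T y) = 0) {t : ℝ} (ht : t ∈ Set.Icc (0 : ℝ) 1) :
    ∃ a b : ℂ, ‖a • x + b • y‖ = 1 ∧
      inner ℂ (a • x + b • y) (T (a • x + b • y)) = (t : ℂ) := by
  set α := inner ℂ x (T y) with hα
  set β := inner ℂ y (T x) with hβ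
  -- The phase `c` makes the cross terms real, so the form is real along the segment from `c • y` to
  -- `x` and the intermediate value theorem applies.
  obtain ⟨c, hc, him⟩ : ∃ c : ℂ, ‖c‖ = 1 ∧ (c * α + (starRingEnd ℂ) c * β).im = 0 := by
    by_cases hγ : α - (starRingEnd ℂ) β = 0
    · refine ⟨1, by simp, ?_⟩
      rw [sub_eq_zero] at hγ
      simp [hγ]
    · set γ := α - (starRingEnd ℂ) β with hg
      have hn : (‖γ‖ : ℂ) ≠ 0 := by exact_mod_cast norm_ne_zero_iff.mpr hγ
      refine ⟨(starRingEnd ℂ) γ / ‖γ‖, by simp [norm_ne_zero_iff.mpr hγ], ?_⟩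
      have h1 : ∀ c : ℂ, (c * α + (starRingEnd ℂ) c * β).im = (c * γ).im := by
        intro c
        simp [hg, Complex.mul_im]
        ring
      rw [h1, div_mul_eq_mul_div, mul_comm, Complex.mul_conj, Complex.normSq_eq_norm_sq]
      rw [← Complex.ofReal_div]
      exact Complex.ofReal_im _
  set z : ℝ → E := fun r => (r : ℂ) • x + ((1 - r : ℝ) * c : ℂ) • y with hz
  have hval : ∀ r, (inner ℂ (z r) (T (z r)) : ℂ) =
      ((r ^ 2 + r * (1 - r) * (c * α + (starRingEnd ℂ) c * β).re : ℝ) : ℂ) := by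
    intro r
    have him' : c * α + (starRingEnd ℂ) c * β =
        ((c * α + (starRingEnd ℂ) c * β).re : ℂ) := by
      apply Complex.ext <;> simp [him]
    push_cast
    rw [← him']
    simp only [hz, map_add, map_smul, inner_add_left, inner_add_right, inner_smul_left,
      inner_smul_right, hTx, hTy, ← hα, ← hβ, map_mul, Complex.conj_ofReal]
    push_cast
    ring
  -- The form is `1` at `x` and `0` at `y`, so a vanishing combination forces `r = 0`, and then `c •
  -- y = 0`.
  have hne : ∀ r, z r ≠ 0 := by
    intro r h0
    have hxy : (r : ℂ) • x = -(((1 - r : ℝ) * c : ℂ) • y) := eq_neg_of_add_eq_zero_left h0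
    have h1 : (r : ℂ) ^ 2 = 0 := by
      have : inner ℂ ((r : ℂ) • x) (T ((r : ℂ) • x)) =
          inner ℂ (-(((1 - r : ℝ) * c : ℂ) • y)) (T (-(((1 - r : ℝ) * c : ℂ) • y))) := by
        rw [hxy]
      simp only [map_neg, map_smul, inner_neg_left, inner_neg_right, inner_smul_left,
        inner_smul_right, hTx, hTy, Complex.conj_ofReal] at this
      linear_combination this
    have h2 : r = 0 := by simpa using h1
    have h3 := congrArg norm hxy
    simp [h2, norm_smul, hc, hy] at h3
  have hcont : Continuous z := by fun_prop
  have hf : Continuous fun r : ℝ =>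
      (r ^ 2 + r * (1 - r) * (c * α + (starRingEnd ℂ) c * β).re) / ‖z r‖ ^ 2 :=
    Continuous.div (by fun_prop) (by fun_prop) fun r => by simpa using hne r
  have hz1 : ‖z 1‖ = 1 := by simp [hz, hx]
  have himg := intermediate_value_Icc (zero_le_one' ℝ) hf.continuousOn
  obtain ⟨r, -, hr⟩ := himg (by simpa [hz1] using ht)
  have hnr : (‖z r‖ : ℂ) ≠ 0 := by exact_mod_cast norm_ne_zero_iff.mpr (hne r)
  refine ⟨(‖z r‖ : ℂ)⁻¹ * r, (‖z r‖ : ℂ)⁻¹ * ((1 - r : ℝ) * c), ?_, ?_⟩ <;>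
    rw [mul_smul, mul_smul _ _ y, ← smul_add]
  · change ‖(‖z r‖ : ℂ)⁻¹ • z r‖ = 1
    have := norm_ne_zero_iff.mpr (hne r)
    simp [norm_smul, this]
  · change inner ℂ ((‖z r‖ : ℂ)⁻¹ • z r) (T ((‖z r‖ : ℂ)⁻¹ • z r)) = (t : ℂ)
    rw [map_smul, inner_smul_left, inner_smul_right, hval, ← hr]
    push_cast
    simp
    field_simp

/-- **Toeplitz-Hausdorff theorem**: the numerical range is convex, with an explicit location
of the intermediate vector. -/
theorem exists_inner_eq_convex_combination {E : Type*} [NormedAddCommGroup E]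
    [InnerProductSpace ℂ E] (T : E →ₗ[ℂ] E) {x y : E} (hx : ‖x‖ = 1) (hy : ‖y‖ = 1)
    {t : ℝ} (ht : t ∈ Set.Icc (0 : ℝ) 1) :
    ∃ a b : ℂ, ‖a • x + b • y‖ = 1 ∧ inner ℂ (a • x + b • y) (T (a • x + b • y)) =
      t * inner ℂ x (T x) + (1 - t) * inner ℂ y (T y) := by
  set p := inner ℂ x (T x) with hp
  set q := inner ℂ y (T y) with hq
  by_cases h : p = q
  · refine ⟨1, 0, by simp [hx], ?_⟩
    simp only [one_smul, zero_smul, add_zero, ← hp, h]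
    ring
  · have hpq : p - q ≠ 0 := sub_ne_zero.mpr h
    obtain ⟨a, b, h1, h2⟩ := exists_inner_eq_of_one_zero
      ((p - q)⁻¹ • (T - q • LinearMap.id)) hx hy
      (by simp [← hp, inner_self_eq_norm_sq_to_K, hx, hpq])
      (by simp [← hq, inner_self_eq_norm_sq_to_K, hy]) ht
    refine ⟨a, b, h1, ?_⟩
    generalize a • x + b • y = z at *
    simp only [LinearMap.smul_apply, LinearMap.sub_apply, LinearMap.id_apply, inner_smul_right,
      inner_sub_right, inner_self_eq_norm_sq_to_K, h1] at h2
    field_simp at h2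
    simp at h2
    linear_combination h2

/-- If a quadratic form restricted to the unit vectors of a plane is maximal at two spanning
vectors, then it is constant there. -/
theorem re_inner_eq_of_maximal {E : Type*} [NormedAddCommGroup E] [InnerProductSpace ℂ E]
    (P : E →ₗ[ℂ] E) {x y : E} (hx : ‖x‖ = 1) (hy : ‖y‖ = 1)
    (hxm : ∀ a b : ℂ, ‖a • x + b • y‖ = 1 →
      (inner ℂ (a • x + b • y) (P (a • x + b • y))).re ≤ (inner ℂ x (P x)).re)
    (hym : ∀ a b : ℂ, ‖a • x + b • y‖ = 1 →
      (inner ℂ (a • x + b • y) (P (a • x + b • y))).re ≤ (inner ℂ y (P y)).re)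
    (a b : ℂ) (hab : ‖a • x + b • y‖ = 1) :
    (inner ℂ (a • x + b • y) (P (a • x + b • y))).re = (inner ℂ x (P x)).re := by
  set c := (inner ℂ x (P x)).re with hc
  have hcy : (inner ℂ y (P y)).re = c := by
    have h1 := hxm 0 1 (by simpa using hy)
    have h2 := hym 1 0 (by simpa using hx)
    simp only [zero_smul, one_smul, zero_add, add_zero] at h1 h2
    exact le_antisymm h1 h2
  -- The defect `D` is a quadratic form, nonnegative on the plane and zero at `x` and `y`. The
  -- parallelogram law gives `D (ax + by) + D (ax - by) = 0`, so both terms vanish.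
  set D : E → ℝ := fun w => c * ‖w‖ ^ 2 - (inner ℂ w (P w)).re with hD
  have hsmul : ∀ (r : ℂ) (w : E), D (r • w) = ‖r‖ ^ 2 * D w := by
    intro r w
    have : inner ℂ (r • w) (P (r • w)) = ((‖r‖ ^ 2 : ℝ) : ℂ) * inner ℂ w (P w) := by
      rw [map_smul, inner_smul_left, inner_smul_right, ← mul_assoc, Complex.conj_mul']
      push_cast
      rfl
    simp only [hD, this, Complex.re_ofReal_mul, norm_smul]
    ring
  have hpos : ∀ a b : ℂ, 0 ≤ D (a • x + b • y) := by
    intro a b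
    by_cases h0 : a • x + b • y = 0
    · simp [hD, h0]
    · have hn := norm_ne_zero_iff.mpr h0
      set r : ℂ := (‖a • x + b • y‖ : ℂ)⁻¹ with hr
      have hrn : ‖r‖ * ‖a • x + b • y‖ = 1 := by
        simp [hr, hn]
      have h1 := hxm (r * a) (r * b) (by rw [mul_smul, mul_smul, ← smul_add, norm_smul, hrn])
      have h2 := hsmul r (a • x + b • y)
      have h3 : 0 ≤ D (r • (a • x + b • y)) := by
        simp only [hD, norm_smul, hrn]
        rw [mul_smul, mul_smul, ← smul_add] at h1
        linarith
      rw [h2] at h3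
      have h4 : 0 < ‖r‖ ^ 2 := by
        have : ‖r‖ ≠ 0 := fun h => by simp [h] at hrn
        positivity
      exact nonneg_of_mul_nonneg_right h3 h4
  have hpar : D (a • x + b • y) + D (a • x - b • y) = 2 * (D (a • x) + D (b • y)) := by
    have := parallelogram_law_with_norm ℂ (a • x) (b • y)
    simp only [hD, map_add, map_sub, inner_add_left, inner_add_right, inner_sub_left,
      inner_sub_right, Complex.add_re, Complex.sub_re]
    linear_combination c * this
  have hDx : D x = 0 := by simp [hD, hx, hc]
  have hDy : D y = 0 := by simp [hD, hy, hcy]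
  rw [hsmul, hsmul, hDx, hDy] at hpar
  have h1 := hpos a b
  have h2 := hpos a (-b)
  rw [neg_smul, ← sub_eq_add_neg] at h2
  have h3 : D (a • x + b • y) = 0 := by linarith
  simp only [hD, hab] at h3
  linarith

/-- Convexity of the higher numerical range of `T` restricted to those orthonormal families at
which the quadratic form of `P` is maximal. -/
theorem convex_image_sum_inner {E : Type*} [NormedAddCommGroup E] [InnerProductSpace ℂ E]
    [FiniteDimensional ℂ E] {k : ℕ} (P T : E →ₗ[ℂ] E) (N : ℝ)
    (hN : ∀ w : Fin k → E, Orthonormal ℂ w → (∑ i, inner ℂ (w i) (P (w i))).re ≤ N) :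
    Convex ℝ ((fun u : Fin k → E => ∑ i, inner ℂ (u i) (T (u i))) ''
      {u | Orthonormal ℂ u ∧ (∑ i, inner ℂ (u i) (P (u i))).re = N}) := by
  rintro _ ⟨u, ⟨hu, huN⟩, rfl⟩ _ ⟨v, ⟨hv, hvN⟩, rfl⟩ t t' ht ht' htt
  set M := Submodule.span ℂ (Set.range u)
  set M' := Submodule.span ℂ (Set.range v)
  obtain ⟨bu, hbu⟩ : ∃ b : OrthonormalBasis (Fin k) ℂ M, ∀ i, (b i : E) = u i :=
    hu.exists_orthonormalBasis_span
  obtain ⟨bv, hbv⟩ : ∃ b : OrthonormalBasis (Fin k) ℂ M', ∀ i, (b i : E) = v i :=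
    hv.exists_orthonormalBasis_span
  -- Principal vectors of the two spans: for distinct `i` the spaces spanned by `x i`, `y i` are
  -- mutually orthogonal, so unit vectors may be chosen in each independently.
  obtain ⟨x, y, hxy⟩ := LinearMap.exists_singularValues_basis (k := k)
    (M'.orthogonalProjectionOnto.toLinearMap ∘ₗ M.subtype)
    (by simpa using Module.finrank_eq_card_basis bu.toBasis)
    (by simpa using Module.finrank_eq_card_basis bv.toBasis)
  have hX := x.orthonormal_coe
  have hY := y.orthonormal_coe
  have hsu : ∀ S : E →ₗ[ℂ] E, ∑ i, inner ℂ (u i) (S (u i)) =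
      ∑ i, inner ℂ (x i : E) (S (x i)) := fun S => by
    rw [← bu.sum_inner_coe_eq x S]
    simp only [hbu]
  have hsv : ∀ S : E →ₗ[ℂ] E, ∑ i, inner ℂ (v i) (S (v i)) =
      ∑ i, inner ℂ (y i : E) (S (y i)) := fun S => by
    rw [← bv.sum_inner_coe_eq y S]
    simp only [hbv]
  have hYX : ∀ i j, i ≠ j → inner ℂ (y i : E) (x j : E) = 0 := by
    intro i j hij
    have h := congrArg (inner ℂ (y i)) (hxy j)
    rw [inner_smul_right, y.inner_eq_zero hij, mul_zero] at h
    simpa using h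
  have hXY : ∀ i j, i ≠ j → inner ℂ (x i : E) (y j : E) = 0 := by
    intro i j hij
    rw [← inner_conj_symm, hYX j i hij.symm, map_zero]
  have hort : ∀ w : Fin k → E, (∀ i, ∃ a b : ℂ, w i = a • (x i : E) + b • (y i : E)) →
      (∀ i, ‖w i‖ = 1) → Orthonormal ℂ w := by
    intro w hw hw1
    refine ⟨hw1, fun i j hij => ?_⟩
    obtain ⟨a, b, h1⟩ := hw i
    obtain ⟨a', b', h2⟩ := hw j
    have e1 := hX.2 hij
    have e2 := hY.2 hij
    simp only [h1, h2, inner_add_left, inner_add_right, inner_smul_left, inner_smul_right, e1, e2,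
      hXY i j hij, hYX i j hij, mul_zero, add_zero]
  have hmax : ∀ (e : Fin k → E), (∀ i, ∃ a b : ℂ, e i = a • (x i : E) + b • (y i : E)) →
      (∀ i, ‖e i‖ = 1) → (∑ i, inner ℂ (e i) (P (e i))).re = N →
      ∀ i (a b : ℂ), ‖a • (x i : E) + b • (y i : E)‖ = 1 →
      (inner ℂ (a • (x i : E) + b • (y i : E)) (P (a • (x i : E) + b • (y i : E)))).re ≤
        (inner ℂ (e i) (P (e i))).re := by
    intro e he he1 heN i a b hab
    set z := a • (x i : E) + b • (y i : E) with hz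
    -- Replacing a single member changes only the `i`-th term, so maximality of the sum gives
    -- maximality in each plane.
    have h := hN (Function.update e i z) (hort _ (fun j => by
      by_cases hj : j = i
      · subst hj; exact ⟨a, b, by simp [hz]⟩
      · simpa [hj] using he j) fun j => by
      by_cases hj : j = i
      · subst hj; simpa using hab
      · simpa [hj] using he1 j)
    rw [← heN, ← sub_nonpos, ← Complex.sub_re, ← Finset.sum_sub_distrib,
      Finset.sum_eq_single i (fun j _ hj => by simp [hj]) (by simp)] at h
    simpa using h
  have hx1 := hX.1
  have hy1 := hY.1
  choose a b h1 h2 using fun i => exists_inner_eq_convex_combination T (hx1 i) (hy1 i)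
    (t := t) ⟨ht, by linarith⟩
  refine ⟨fun i => a i • (x i : E) + b i • (y i : E), ⟨hort _ (fun i => ⟨_, _, rfl⟩) h1, ?_⟩, ?_⟩
  · rw [← huN, hsu P, Complex.re_sum, Complex.re_sum]
    refine Finset.sum_congr rfl fun i _ => ?_
    exact re_inner_eq_of_maximal P (hx1 i) (hy1 i)
      (hmax (fun i => (x i : E)) (fun i => ⟨1, 0, by simp⟩) hx1 (by rw [← hsu P, huN]) i)
      (hmax (fun i => (y i : E)) (fun i => ⟨0, 1, by simp⟩) hy1 (by rw [← hsv P, hvN]) i)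
      (a i) (b i) (h1 i)
  · have ht2 : (t' : ℂ) = 1 - t := by
      rw [eq_sub_iff_add_eq']; exact_mod_cast htt
    simp only [h2, hsu T, hsv T, Finset.sum_add_distrib, ← Finset.mul_sum, Complex.real_smul, ht2]

/-! ### The Ky Fan inequality and its equality case -/

/-- The weights `d` and the indicator of `j < k` have the same total, so `s` may be shifted by any
`c`. Taking `c = s (k - 1)` makes each summand nonnegative. -/
theorem sum_range_sub_sum_mul_eq {n k : ℕ} (hkn : k ≤ n) (s : ℕ → ℝ) (c : ℝ) (d : Fin n → ℝ)
    (hd : ∑ j, d j = k) :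
    ∑ i ∈ Finset.range k, s i - ∑ j : Fin n, s j * d j =
      ∑ j : Fin n, (s j - c) * ((if (j : ℕ) < k then 1 else 0) - d j) := by
  have h : ∀ g : ℕ → ℝ, ∑ j : Fin n, g j * (if (j : ℕ) < k then 1 else 0) =
      ∑ i ∈ Finset.range k, g i := by
    intro g
    rw [Fin.sum_univ_eq_sum_range (fun j => g j * (if j < k then 1 else 0)) n]
    rw [← Finset.sum_subset (Finset.range_mono hkn)]
    · refine Finset.sum_congr rfl fun i hi => ?_
      simp [Finset.mem_range.mp hi]
    · intro i _ hi
      simp [Finset.mem_range.not.mp hi]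
  simp only [mul_sub, Finset.sum_sub_distrib, sub_mul, ← Finset.mul_sum, hd]
  have h1 := h fun _ => 1
  simp only [one_mul, Finset.sum_const, Finset.card_range, nsmul_eq_mul, mul_one] at h1
  rw [h s, h1]
  ring

theorem sub_mul_indicator_sub_nonneg {k : ℕ} {s : ℕ → ℝ} (hs : Antitone s) {d : ℝ} (h0 : 0 ≤ d)
    (h1 : d ≤ 1) (j : ℕ) :
    0 ≤ (s j - s (k - 1)) * ((if j < k then 1 else 0) - d) := by
  split_ifs with h
  · exact mul_nonneg (sub_nonneg.mpr (hs (by omega))) (by linarith)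
  · exact mul_nonneg_of_nonpos_of_nonpos (sub_nonpos.mpr (hs (by omega))) (by linarith)

section OrthonormalFamilies

variable {E : Type*} [NormedAddCommGroup E] [InnerProductSpace ℂ E] {n k : ℕ}

theorem Orthonormal.sum_sq_norm_inner_le_one (e : OrthonormalBasis (Fin n) ℂ E) {u : Fin k → E}
    (hu : Orthonormal ℂ u) (j : Fin n) : ∑ i, ‖inner ℂ (e j) (u i)‖ ^ 2 ≤ 1 := by
  have h := hu.sum_inner_products_le (e j) (s := Finset.univ)
  simpa [norm_inner_symm] using h

theorem Orthonormal.sum_sum_sq_norm_inner (e : OrthonormalBasis (Fin n) ℂ E) {u : Fin k → E}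
    (hu : Orthonormal ℂ u) : ∑ j, ∑ i, ‖inner ℂ (e j) (u i)‖ ^ 2 = (k : ℝ) := by
  rw [Finset.sum_comm]
  simp [e.sum_sq_norm_inner_right, hu.1]

/-- The Ky Fan inequality for a diagonal quadratic form. -/
theorem Orthonormal.sum_diagonal_le (hkn : k ≤ n) {s : ℕ → ℝ} (hs : Antitone s)
    (e : OrthonormalBasis (Fin n) ℂ E) {u : Fin k → E} (hu : Orthonormal ℂ u) :
    ∑ j : Fin n, s j * ∑ i, ‖inner ℂ (e j) (u i)‖ ^ 2 ≤ ∑ i ∈ Finset.range k, s i := by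
  rw [← sub_nonneg, sum_range_sub_sum_mul_eq hkn s (s (k - 1)) _ (hu.sum_sum_sq_norm_inner e)]
  exact Finset.sum_nonneg fun j _ => sub_mul_indicator_sub_nonneg hs
    (Finset.sum_nonneg fun _ _ => sq_nonneg _) (hu.sum_sq_norm_inner_le_one e j) j

/-- The equality case of the Ky Fan inequality. -/
theorem Orthonormal.of_sum_diagonal_eq (hkn : k ≤ n) {s : ℕ → ℝ} (hs : Antitone s)
    (e : OrthonormalBasis (Fin n) ℂ E) {u : Fin k → E} (hu : Orthonormal ℂ u)
    (h : ∑ j : Fin n, s j * ∑ i, ‖inner ℂ (e j) (u i)‖ ^ 2 = ∑ i ∈ Finset.range k, s i)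
    (j : Fin n) :
    (s j < s (k - 1) → ∀ i, inner ℂ (e j) (u i) = 0) ∧
      (s (k - 1) < s j → ∑ i, ‖inner ℂ (e j) (u i)‖ ^ 2 = 1) := by
  have h' := sum_range_sub_sum_mul_eq hkn s (s (k - 1)) _ (hu.sum_sum_sq_norm_inner e)
  rw [h, sub_self, eq_comm, Finset.sum_eq_zero_iff_of_nonneg fun j _ =>
    sub_mul_indicator_sub_nonneg hs (Finset.sum_nonneg fun _ _ => sq_nonneg _)
      (hu.sum_sq_norm_inner_le_one e j) j] at h'
  have hj := h' j (Finset.mem_univ _)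
  constructor
  · intro hlt
    have hjk : ¬ (j : ℕ) < k := fun hjk => absurd (hs (show (j : ℕ) ≤ k - 1 by omega)) hlt.not_ge
    rw [if_neg hjk] at hj
    have h0 : ∑ i, ‖inner ℂ (e j) (u i)‖ ^ 2 = 0 := by
      rcases mul_eq_zero.mp hj with h | h <;> linarith
    rw [Finset.sum_eq_zero_iff_of_nonneg fun _ _ => sq_nonneg _] at h0
    intro i
    simpa using h0 i (Finset.mem_univ _)
  · intro hlt
    have hjk : (j : ℕ) < k := by
      by_contra hjk
      exact absurd (hs (show k - 1 ≤ (j : ℕ) by omega)) hlt.not_ge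
    rw [if_pos hjk] at hj
    rcases mul_eq_zero.mp hj with h | h <;> linarith

/-- Polarization of `⟪v, T u⟫` in singular bases of `T`. -/
theorem re_inner_eq_of_singular_bases {s : ℕ → ℝ} (e f : OrthonormalBasis (Fin n) ℂ E)
    (T : E →ₗ[ℂ] E) (hT : ∀ j : Fin n, T (e j) = (s j : ℂ) • f j) (u v : E) :
    (inner ℂ v (T u)).re = ((∑ j : Fin n, s j * ‖inner ℂ (e j) u‖ ^ 2 +
      ∑ j : Fin n, s j * ‖inner ℂ (f j) v‖ ^ 2) -
      ∑ j : Fin n, s j * ‖inner ℂ (e j) u - inner ℂ (f j) v‖ ^ 2) / 2 := by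
  have h : inner ℂ v (T u) =
      ∑ j : Fin n, (s j : ℂ) * (inner ℂ (e j) u * (starRingEnd ℂ) (inner ℂ (f j) v)) := by
    conv_lhs => rw [← e.sum_repr' u, map_sum, inner_sum]
    refine Finset.sum_congr rfl fun j _ => ?_
    rw [map_smul, hT, inner_smul_right, inner_smul_right, inner_conj_symm]
    ring
  rw [h, Complex.re_sum, ← Finset.sum_add_distrib, ← Finset.sum_sub_distrib, Finset.sum_div]
  refine Finset.sum_congr rfl fun j _ => ?_
  rw [Complex.re_ofReal_mul, Complex.sq_norm, Complex.sq_norm, Complex.sq_norm,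
    Complex.normSq_sub]
  ring

/-- For nonnegative `s` the last sum is a nonnegative defect. Equality in the Ky Fan bound thus
forces both diagonal sums to be maximal and the defect to vanish. -/
theorem re_sum_inner_eq_of_singular_bases {s : ℕ → ℝ} (e f : OrthonormalBasis (Fin n) ℂ E)
    (T : E →ₗ[ℂ] E) (hT : ∀ j : Fin n, T (e j) = (s j : ℂ) • f j) (u v : Fin k → E) :
    (∑ i, inner ℂ (v i) (T (u i))).re =
      ((∑ j : Fin n, s j * ∑ i, ‖inner ℂ (e j) (u i)‖ ^ 2 +
      ∑ j : Fin n, s j * ∑ i, ‖inner ℂ (f j) (v i)‖ ^ 2) -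
      ∑ j : Fin n, s j * ∑ i, ‖inner ℂ (e j) (u i) - inner ℂ (f j) (v i)‖ ^ 2) / 2 := by
  simp only [Complex.re_sum, re_inner_eq_of_singular_bases e f T hT, Finset.mul_sum]
  rw [Finset.sum_comm (s := (Finset.univ : Finset (Fin n))),
    Finset.sum_comm (s := (Finset.univ : Finset (Fin n))),
    Finset.sum_comm (s := (Finset.univ : Finset (Fin n))), ← Finset.sum_add_distrib,
    ← Finset.sum_sub_distrib, Finset.sum_div]

/-- The variational upper bound for the sum of the `k` largest singular values. -/
theorem re_sum_inner_le (hkn : k ≤ n) {s : ℕ → ℝ} (hs : Antitone s) (hs0 : ∀ i, 0 ≤ s i)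
    (e f : OrthonormalBasis (Fin n) ℂ E) (T : E →ₗ[ℂ] E)
    (hT : ∀ j : Fin n, T (e j) = (s j : ℂ) • f j) {u v : Fin k → E} (hu : Orthonormal ℂ u)
    (hv : Orthonormal ℂ v) :
    (∑ i, inner ℂ (v i) (T (u i))).re ≤ ∑ i ∈ Finset.range k, s i := by
  rw [re_sum_inner_eq_of_singular_bases e f T hT]
  have h1 := hu.sum_diagonal_le hkn hs e
  have h2 := hv.sum_diagonal_le hkn hs f
  have h3 : 0 ≤ ∑ j : Fin n, s j * ∑ i, ‖inner ℂ (e j) (u i) - inner ℂ (f j) (v i)‖ ^ 2 :=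
    Finset.sum_nonneg fun j _ => mul_nonneg (hs0 j) (Finset.sum_nonneg fun _ _ => sq_nonneg _)
  linarith

/-- Equality in the variational bound, when the `k`-th singular value is positive. -/
theorem of_re_sum_inner_eq (hkn : k ≤ n) {s : ℕ → ℝ} (hs : Antitone s) (hs0 : ∀ i, 0 ≤ s i)
    (hpos : 0 < s (k - 1)) (e f : OrthonormalBasis (Fin n) ℂ E) (T : E →ₗ[ℂ] E)
    (hT : ∀ j : Fin n, T (e j) = (s j : ℂ) • f j) {u v : Fin k → E} (hu : Orthonormal ℂ u)
    (hv : Orthonormal ℂ v)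
    (h : (∑ i, inner ℂ (v i) (T (u i))).re = ∑ i ∈ Finset.range k, s i) :
    ∑ j : Fin n, s j * ∑ i, ‖inner ℂ (e j) (u i)‖ ^ 2 = ∑ i ∈ Finset.range k, s i ∧
      ∀ i j, inner ℂ (e j) (u i) = inner ℂ (f j) (v i) := by
  rw [re_sum_inner_eq_of_singular_bases e f T hT] at h
  have h1 := hu.sum_diagonal_le hkn hs e
  have h2 := hv.sum_diagonal_le hkn hs f
  have hnn : ∀ j : Fin n,
      0 ≤ s j * ∑ i, ‖inner ℂ (e j) (u i) - inner ℂ (f j) (v i)‖ ^ 2 :=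
    fun j => mul_nonneg (hs0 j) (Finset.sum_nonneg fun _ _ => sq_nonneg _)
  have h3 := Finset.sum_nonneg fun j (_ : j ∈ Finset.univ) => hnn j
  have hu1 : ∑ j : Fin n, s j * ∑ i, ‖inner ℂ (e j) (u i)‖ ^ 2 = ∑ i ∈ Finset.range k, s i := by
    linarith
  have hv1 : ∑ j : Fin n, s j * ∑ i, ‖inner ℂ (f j) (v i)‖ ^ 2 = ∑ i ∈ Finset.range k, s i := by
    linarith
  have h4 : ∑ j : Fin n, s j * ∑ i, ‖inner ℂ (e j) (u i) - inner ℂ (f j) (v i)‖ ^ 2 = 0 := by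
    linarith
  refine ⟨hu1, fun i j => ?_⟩
  -- Below the threshold both coefficients vanish; at or above it `s j > 0`, so the vanishing
  -- weighted defect forces them to agree.
  rcases lt_or_ge (s j) (s (k - 1)) with hlt | hge
  · rw [(hu.of_sum_diagonal_eq hkn hs e hu1 j).1 hlt, (hv.of_sum_diagonal_eq hkn hs f hv1 j).1 hlt]
  · rw [Finset.sum_eq_zero_iff_of_nonneg fun j _ => hnn j] at h4
    have h5 := (mul_eq_zero.mp (h4 j (Finset.mem_univ _))).resolve_left (hpos.trans_le hge).ne'
    rw [Finset.sum_eq_zero_iff_of_nonneg fun _ _ => sq_nonneg _] at h5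
    simpa [sub_eq_zero] using h5 i (Finset.mem_univ _)

/-- A family extremal for the Ky Fan inequality spans a subspace which has an orthonormal basis
of eigenvectors for the `k` largest eigenvalues. -/
theorem Orthonormal.exists_eigenvectors_of_sum_diagonal_eq [FiniteDimensional ℂ E]
    (hkn : k ≤ n) {s : ℕ → ℝ} (hs : Antitone s) (e : OrthonormalBasis (Fin n) ℂ E)
    (P : E →ₗ[ℂ] E) (hP : ∀ j : Fin n, P (e j) = (s j : ℂ) • e j) {u : Fin k → E}
    (hu : Orthonormal ℂ u)
    (h : ∑ j : Fin n, s j * ∑ i, ‖inner ℂ (e j) (u i)‖ ^ 2 = ∑ i ∈ Finset.range k, s i) :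
    ∃ w : Fin k → E, Orthonormal ℂ w ∧ (∀ i, P (w i) = (s i : ℂ) • w i) ∧
      ∀ T : E →ₗ[ℂ] E, ∑ i, inner ℂ (w i) (T (w i)) = ∑ i, inner ℂ (u i) (T (u i)) := by
  have key := hu.of_sum_diagonal_eq hkn hs e h
  set M := Submodule.span ℂ (Set.range u)
  obtain ⟨b, hb⟩ : ∃ b : OrthonormalBasis (Fin k) ℂ M, ∀ i, (b i : E) = u i :=
    hu.exists_orthonormalBasis_span
  have hmem : ∀ j : Fin n, s (k - 1) < s j → e j ∈ M := by
    intro j hj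
    have h1 := (key j).2 hj
    have h2 := b.sum_sq_norm_inner_right (M.orthogonalProjectionOnto (e j))
    have h3 : ∑ i, ‖inner ℂ (b i) (M.orthogonalProjectionOnto (e j))‖ ^ 2 = 1 := by
      rw [← h1]
      refine Finset.sum_congr rfl fun i _ => ?_
      rw [← hb i, norm_inner_symm (e j)]
      simp
    rw [M.mem_iff_norm_starProjection]
    rw [h3] at h2
    have : ‖M.orthogonalProjectionOnto (e j)‖ = 1 := by
      have := norm_nonneg (M.orthogonalProjectionOnto (e j))
      nlinarith
    simpa using this
  have hperp : ∀ j : Fin n, s j < s (k - 1) → ∀ x ∈ M, inner ℂ (e j) x = 0 := by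
    intro j hj x hx
    induction hx using Submodule.span_induction with
    | mem x hx => obtain ⟨i, rfl⟩ := hx; exact (key j).1 hj i
    | zero => simp
    | add x y _ _ h1 h2 => rw [inner_add_right, h1, h2, add_zero]
    | smul a x _ h1 => rw [inner_smul_right, h1, mul_zero]
  -- Eigenvectors strictly above the threshold lie in `M` and keep their own index. The rest of the
  -- completed basis is orthogonal to them and to all `e j` below the threshold, hence lies in the
  -- eigenspace of `s (k - 1)`. The default `0` is never used.
  let S : Set (Fin k) := {i | s (k - 1) < s i}
  let v : Fin k → M := fun i =>
    if hi : s (k - 1) < s i then ⟨e (i.castLE hkn), hmem _ hi⟩ else 0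
  have hv : ∀ i : Fin k, s (k - 1) < s i → (v i : E) = e (i.castLE hkn) := by
    intro i hi
    simp [v, hi]
  have hvo : Orthonormal ℂ (S.domRestrict v) := by
    constructor
    · rintro ⟨i, hi⟩
      change ‖(v i : E)‖ = 1
      rw [hv i hi, e.norm_eq_one]
    · rintro ⟨i, hi⟩ ⟨j, hj⟩ hij
      change inner ℂ (v i : E) (v j : E) = 0
      rw [hv i hi, hv j hj]
      exact e.inner_eq_zero fun h' => hij (by simpa using h')
  obtain ⟨w, hw⟩ := hvo.exists_orthonormalBasis_extension_of_card_eq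
    (by simpa using Module.finrank_eq_card_basis b.toBasis)
  refine ⟨fun i => w i, w.orthonormal_coe, fun i => ?_, fun T => ?_⟩
  · change P (w i : E) = (s i : ℂ) • (w i : E)
    by_cases hi : s (k - 1) < s i
    · rw [hw i hi, hv i hi, hP]
      simp
    · have hsi : s i = s (k - 1) := le_antisymm (not_lt.mp hi) (hs (by omega))
      have hz : ∀ j : Fin n, s j ≠ s (k - 1) → inner ℂ (e j) (w i : E) = 0 := by
        intro j hj
        rcases lt_or_gt_of_ne hj with hlt | hgt
        · exact hperp j hlt _ (w i).2
        · have hjk : (j : ℕ) < k := by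
            by_contra hjk
            exact absurd (hs (show k - 1 ≤ (j : ℕ) by omega)) hgt.not_ge
          have h1 : (w ⟨j, hjk⟩ : E) = e j := by
            rw [hw ⟨j, hjk⟩ hgt, hv ⟨j, hjk⟩ hgt]
            simp
          rw [← h1]
          exact w.orthonormal_coe.2 fun h' => hi (by rw [← h']; exact hgt)
      conv_lhs => rw [← e.sum_repr' (w i : E), map_sum]
      conv_rhs => rw [← e.sum_repr' (w i : E), Finset.smul_sum]
      refine Finset.sum_congr rfl fun j _ => ?_
      rw [map_smul, hP, smul_comm]
      by_cases hj : s j = s (k - 1)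
      · rw [hj, hsi]
      · rw [hz j hj]
        simp
  · rw [w.sum_inner_coe_eq b T]
    simp only [hb]

end OrthonormalFamilies

/-! ### Compactness, separation and positive square roots -/

theorem isCompact_setOf_orthonormal {E : Type*} [NormedAddCommGroup E] [InnerProductSpace ℂ E]
    [FiniteDimensional ℂ E] (k : ℕ) : IsCompact {u : Fin k → E | Orthonormal ℂ u} := by
  have : ProperSpace E := FiniteDimensional.proper ℂ E
  refine Metric.isCompact_of_isClosed_isBounded ?_ ?_
  · simp only [orthonormal_iff_ite, Set.ofPred_forall]
    exact isClosed_iInter fun i => isClosed_iInter fun j =>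
      isClosed_eq (by fun_prop) continuous_const
  · refine (Metric.isBounded_closedBall (x := (0 : Fin k → E)) (r := 1)).subset fun u hu => ?_
    rw [mem_closedBall_zero_iff, pi_norm_le_iff_of_nonneg zero_le_one]
    exact fun i => (hu.1 i).le

/-- A first-order optimality principle on a compact set. -/
theorem IsCompact.exists_eq_zero_and_nonpos {X : Type*} [TopologicalSpace X]
    [FirstCountableTopology X] {K : Set X} (hK : IsCompact K) {g h : X → ℝ} (hg : Continuous g)
    (hh : Continuous h) (hg0 : ∀ p ∈ K, 0 ≤ g p)
    (hex : ∀ t : ℝ, 0 < t → ∃ p ∈ K, g p + t * h p ≤ 0) :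
    ∃ p ∈ K, g p = 0 ∧ h p ≤ 0 := by
  choose p hpK hp using fun m : ℕ => hex (1 / ((m : ℝ) + 1)) Nat.one_div_pos_of_nat
  obtain ⟨q, hq, φ, hφ, hlim⟩ := hK.tendsto_subseq hpK
  have hg' := (hg.tendsto q).comp hlim
  have hh' := (hh.tendsto q).comp hlim
  refine ⟨q, hq, le_antisymm ?_ (hg0 q hq), ?_⟩
  · have ht : Filter.Tendsto (fun m : ℕ => 1 / ((φ m : ℝ) + 1)) Filter.atTop (nhds 0) :=
      (tendsto_one_div_add_atTop_nhds_zero_nat (𝕜 := ℝ)).comp hφ.tendsto_atTop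
    have hl := hg'.add (ht.mul hh')
    rw [zero_mul, add_zero] at hl
    exact le_of_tendsto' hl fun m => hp (φ m)
  · refine le_of_tendsto' hh' fun m => ?_
    have h1 := hg0 _ (hpK (φ m))
    have h2 := hp (φ m)
    have h3 : (0 : ℝ) < 1 / ((φ m : ℝ) + 1) := Nat.one_div_pos_of_nat
    exact nonpos_of_mul_nonpos_right (by simpa using (by linarith :
      1 / ((φ m : ℝ) + 1) * h (p (φ m)) ≤ 0)) h3

/-- A compact convex set in the plane meeting all closed half-planes through the origin
contains the origin. -/
theorem Complex.zero_mem_of_forall_exists_re_nonpos {S : Set ℂ} (hc : Convex ℝ S)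
    (hS : IsCompact S) (h : ∀ z : ℂ, ∃ w ∈ S, (z * w).re ≤ 0) : (0 : ℂ) ∈ S := by
  by_contra h0
  obtain ⟨f, r, h1, h2⟩ := RCLike.geometric_hahn_banach_point_closed (𝕜 := ℂ) hc hS.isClosed h0
  -- A complex-linear functional on `ℂ` is multiplication by its value at `1`, which is the
  -- direction to test.
  obtain ⟨w, hw, hle⟩ := h (f 1)
  have h3 := h2 w hw
  have h4 : f w = f 1 * w := by
    rw [← mul_one w, ← smul_eq_mul, map_smul, smul_eq_mul]
    simp [mul_comm]
  rw [map_zero, map_zero] at h1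
  rw [h4] at h3
  exact absurd (h1.trans h3) hle.not_gt

/-- Since `(P + s)(P - s) x = 0`, the vector `w = (P - s) x` satisfies `P w = -s w`, which
positivity excludes for `s > 0` unless `w = 0`. For `s = 0`, `‖P x‖² = ⟪x, P (P x)⟫ = 0`. -/
theorem LinearMap.IsPositive.apply_eq_smul_of_apply_apply {E : Type*} [NormedAddCommGroup E]
    [InnerProductSpace ℂ E] {P : E →ₗ[ℂ] E} (hP : P.IsPositive) {s : ℝ} (hs : 0 ≤ s) {x : E}
    (hx : P (P x) = ((s ^ 2 : ℝ) : ℂ) • x) : P x = (s : ℂ) • x := by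
  rcases hs.eq_or_lt with rfl | hs
  · have h : inner ℂ (P x) (P x) = (0 : ℂ) := by
      rw [hP.isSymmetric, hx]
      simp
    simpa using h
  · set w := P x - (s : ℂ) • x with hw
    have h1 : P w = -((s : ℂ) • w) := by
      rw [hw, map_sub, map_smul, hx, smul_sub, smul_smul]
      push_cast
      rw [sq]
      abel
    have h2 := hP.re_inner_nonneg_right w
    rw [h1, inner_neg_right, inner_smul_right, inner_self_eq_norm_sq_to_K] at h2
    have h3 : 0 ≤ -(s * ‖w‖ ^ 2) := by
      have : -((s : ℂ) * ((‖w‖ : ℂ)) ^ 2) = ((-(s * ‖w‖ ^ 2) : ℝ) : ℂ) := by push_cast; ring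
      have h2' : 0 ≤ (-((s : ℂ) * ((‖w‖ : ℂ)) ^ 2)).re := h2
      rwa [this, Complex.ofReal_re] at h2'
    have h4 : ‖w‖ ^ 2 = 0 := by
      have := sq_nonneg ‖w‖
      nlinarith
    have h5 : w = 0 := by simpa using h4
    exact sub_eq_zero.mp h5

/-! ### Polar decomposition and the two implications -/

section Matrix

variable {n : ℕ}

theorem Matrix.toEuclideanLin_mul_apply (A B : Matrix (Fin n) (Fin n) ℂ)
    (x : EuclideanSpace ℂ (Fin n)) :
    Matrix.toEuclideanLin (A * B) x = Matrix.toEuclideanLin A (Matrix.toEuclideanLin B x) := by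
  simp [Matrix.toLpLin_apply, Matrix.mulVec_mulVec]

theorem Matrix.inner_toEuclideanLin_conjTranspose (A : Matrix (Fin n) (Fin n) ℂ)
    (x y : EuclideanSpace ℂ (Fin n)) :
    inner ℂ x (Matrix.toEuclideanLin A.conjTranspose y) =
      inner ℂ (Matrix.toEuclideanLin A x) y := by
  rw [Matrix.toEuclideanLin_conjTranspose_eq_adjoint, LinearMap.adjoint_inner_right]

theorem Matrix.inner_toEuclideanLin_of_mem_unitaryGroup {U : Matrix (Fin n) (Fin n) ℂ}
    (hU : U ∈ Matrix.unitaryGroup (Fin n) ℂ) (x y : EuclideanSpace ℂ (Fin n)) :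
    inner ℂ (Matrix.toEuclideanLin U x) (Matrix.toEuclideanLin U y) = inner ℂ x y := by
  rw [← Matrix.inner_toEuclideanLin_conjTranspose, ← Matrix.toEuclideanLin_mul_apply,
    ← Matrix.star_eq_conjTranspose, Matrix.mem_unitaryGroup_iff'.mp hU]
  simp

theorem singVal_antitone (A : Matrix (Fin n) (Fin n) ℂ) : Antitone (singVal A) :=
  LinearMap.singularValues_antitone _

theorem singVal_nonneg (A : Matrix (Fin n) (Fin n) ℂ) (i : ℕ) : 0 ≤ singVal A i :=
  LinearMap.singularValues_nonneg _ i

theorem exists_singVal_basis (A : Matrix (Fin n) (Fin n) ℂ) :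
    ∃ e f : OrthonormalBasis (Fin n) ℂ (EuclideanSpace ℂ (Fin n)),
      ∀ j : Fin n, Matrix.toEuclideanLin A (e j) = (singVal A j : ℂ) • f j :=
  LinearMap.exists_singularValues_basis _ (by simp) (by simp)

/-- Right singular vectors are eigenvectors of `|A|` because `|A|² = A* A`. The left basis is then
taken to be `U e`, which matters when `A` is singular and `U` is not determined by `A`. -/
theorem IsPolarDecomposition.exists_basis {A U : Matrix (Fin n) (Fin n) ℂ}
    (hU : IsPolarDecomposition A U) :
    ∃ e f : OrthonormalBasis (Fin n) ℂ (EuclideanSpace ℂ (Fin n)),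
      (∀ j : Fin n, Matrix.toEuclideanLin A (e j) = (singVal A j : ℂ) • f j) ∧
      (∀ j : Fin n, Matrix.toEuclideanLin (CFC.abs A) (e j) = (singVal A j : ℂ) • e j) ∧
      ∀ j, Matrix.toEuclideanLin U (e j) = f j := by
  obtain ⟨e, y, hy⟩ := exists_singVal_basis A
  have hpos : (Matrix.toEuclideanLin (CFC.abs A)).IsPositive :=
    Matrix.isPositive_toEuclideanLin_iff.mpr (Matrix.nonneg_iff_posSemidef.mp (CFC.abs_nonneg A))
  have he : ∀ j : Fin n, Matrix.toEuclideanLin (CFC.abs A) (e j) = (singVal A j : ℂ) • e j := by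
    intro j
    refine hpos.apply_eq_smul_of_apply_apply (singVal_nonneg A j) ?_
    rw [← Matrix.toEuclideanLin_mul_apply, CFC.abs_mul_abs, Matrix.star_eq_conjTranspose]
    refine InnerProductSpace.ext_inner_left_basis e.toBasis fun i => ?_
    rw [OrthonormalBasis.coe_toBasis, Matrix.toEuclideanLin_mul_apply,
      Matrix.inner_toEuclideanLin_conjTranspose, hy, hy, inner_smul_left, inner_smul_right,
      inner_smul_right, y.inner_eq_ite, e.inner_eq_ite]
    by_cases hij : i = j
    · subst hij
      simp [sq]
    · simp [hij]
  have hin := Matrix.inner_toEuclideanLin_of_mem_unitaryGroup hU.1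
  obtain ⟨f, hf⟩ := exists_orthonormalBasis_of_pairwise_orthogonal (by simp)
    (fun j => Matrix.toEuclideanLin U (e j)) fun i j hij => by
      rw [hin, e.inner_eq_zero hij]
  have hUf : ∀ j, Matrix.toEuclideanLin U (e j) = f j := by
    intro j
    have h1 : ‖Matrix.toEuclideanLin U (e j)‖ = 1 := by
      rw [norm_eq_sqrt_re_inner (𝕜 := ℂ), hin, ← norm_eq_sqrt_re_inner, e.norm_eq_one]
    rw [hf j, h1]
    simp
  refine ⟨e, f, fun j => ?_, he, hUf⟩
  conv_lhs => rw [hU.2]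
  rw [Matrix.toEuclideanLin_mul_apply, he, map_smul, hUf]

theorem kyFanNorm_eq_sum_fin (k : ℕ) (A : Matrix (Fin n) (Fin n) ℂ) :
    kyFanNorm k A = ∑ i : Fin k, singVal A i := by
  rw [kyFanNorm, Finset.sum_range]

theorem re_sum_inner_le_kyFanNorm {k : ℕ} (hkn : k ≤ n) (A : Matrix (Fin n) (Fin n) ℂ)
    {u v : Fin k → EuclideanSpace ℂ (Fin n)} (hu : Orthonormal ℂ u) (hv : Orthonormal ℂ v) :
    (∑ i, inner ℂ (v i) (Matrix.toEuclideanLin A (u i))).re ≤ kyFanNorm k A := by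
  obtain ⟨e, f, hef⟩ := exists_singVal_basis A
  exact re_sum_inner_le hkn (singVal_antitone A) (singVal_nonneg A) e f _ hef hu hv

theorem exists_re_sum_inner_eq_kyFanNorm {k : ℕ} (hkn : k ≤ n) (A : Matrix (Fin n) (Fin n) ℂ) :
    ∃ u v : Fin k → EuclideanSpace ℂ (Fin n), Orthonormal ℂ u ∧ Orthonormal ℂ v ∧
      (∑ i, inner ℂ (v i) (Matrix.toEuclideanLin A (u i))).re = kyFanNorm k A := by
  obtain ⟨e, f, hef⟩ := exists_singVal_basis A
  refine ⟨e ∘ Fin.castLE hkn, f ∘ Fin.castLE hkn,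
    e.orthonormal.comp _ (Fin.castLE_injective hkn),
    f.orthonormal.comp _ (Fin.castLE_injective hkn), ?_⟩
  simp [hef, kyFanNorm_eq_sum_fin]

theorem Orthonormal.toEuclideanLin_unitary {k : ℕ} {U : Matrix (Fin n) (Fin n) ℂ}
    (hU : U ∈ Matrix.unitaryGroup (Fin n) ℂ) {u : Fin k → EuclideanSpace ℂ (Fin n)}
    (hu : Orthonormal ℂ u) : Orthonormal ℂ fun i => Matrix.toEuclideanLin U (u i) := by
  rw [orthonormal_iff_ite] at hu ⊢
  simpa only [Matrix.inner_toEuclideanLin_of_mem_unitaryGroup hU] using hu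

/-- The sufficient condition for orthogonality. -/
theorem IsPolarDecomposition.bjOrthogonal {k : ℕ} (hkn : k ≤ n)
    {A B U : Matrix (Fin n) (Fin n) ℂ} (hU : IsPolarDecomposition A U)
    {u : Fin k → EuclideanSpace ℂ (Fin n)} (hu : Orthonormal ℂ u)
    (hA : ∀ i, Matrix.toEuclideanLin (CFC.abs A) (u i) = (singVal A i : ℂ) • u i)
    (hB : ∑ i, inner ℂ (u i) (Matrix.toEuclideanLin (U.conjTranspose * B) (u i)) = 0) :
    BJOrthogonal (kyFanNorm k) A B := by
  intro c
  refine le_of_eq_of_le ?_ (re_sum_inner_le_kyFanNorm hkn (A + c • B) hu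
    (hu.toEuclideanLin_unitary hU.1))
  have h1 : ∀ i, inner ℂ (Matrix.toEuclideanLin U (u i)) (Matrix.toEuclideanLin A (u i)) =
      (singVal A i : ℂ) := by
    intro i
    have : Matrix.toEuclideanLin A (u i) =
        Matrix.toEuclideanLin U (Matrix.toEuclideanLin (CFC.abs A) (u i)) := by
      rw [← Matrix.toEuclideanLin_mul_apply, ← hU.2]
    rw [this, Matrix.inner_toEuclideanLin_of_mem_unitaryGroup hU.1, hA, inner_smul_right,
      inner_self_eq_norm_sq_to_K, hu.1 i]
    simp
  have h2 : ∑ i, inner ℂ (Matrix.toEuclideanLin U (u i)) (Matrix.toEuclideanLin B (u i)) =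
      (0 : ℂ) := by
    rw [← hB]
    refine Finset.sum_congr rfl fun i _ => ?_
    rw [Matrix.toEuclideanLin_mul_apply, Matrix.inner_toEuclideanLin_conjTranspose]
  simp only [map_add, map_smul, LinearMap.add_apply, LinearMap.smul_apply, inner_add_right,
    inner_smul_right, h1, Finset.sum_add_distrib, ← Finset.mul_sum, h2, mul_zero, add_zero,
    kyFanNorm_eq_sum_fin]
  rw [← Complex.ofReal_sum, Complex.ofReal_re]

/-- For each direction there are extremal families for `A` along which the derivative of the
Ky Fan norm in that direction has the expected sign. -/
theorem BJOrthogonal.exists_re_sum_inner_nonpos {k : ℕ} (hkn : k ≤ n)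
    {A B : Matrix (Fin n) (Fin n) ℂ} (h : BJOrthogonal (kyFanNorm k) A B) (z : ℂ) :
    ∃ u v : Fin k → EuclideanSpace ℂ (Fin n), Orthonormal ℂ u ∧ Orthonormal ℂ v ∧
      (∑ i, inner ℂ (v i) (Matrix.toEuclideanLin A (u i))).re = kyFanNorm k A ∧
      (z * ∑ i, inner ℂ (v i) (Matrix.toEuclideanLin B (u i))).re ≤ 0 := by
  have hcont : ∀ T : EuclideanSpace ℂ (Fin n) →ₗ[ℂ] EuclideanSpace ℂ (Fin n), Continuous T :=
    fun T => T.continuous_of_finiteDimensional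
  have hA := hcont (Matrix.toEuclideanLin A)
  have hB := hcont (Matrix.toEuclideanLin B)
  obtain ⟨⟨u, v⟩, ⟨hu, hv⟩, h1, h2⟩ :=
    ((isCompact_setOf_orthonormal (E := EuclideanSpace ℂ (Fin n)) k).prod
      (isCompact_setOf_orthonormal k)).exists_eq_zero_and_nonpos
    (g := fun p => kyFanNorm k A - (∑ i, inner ℂ (p.2 i) (Matrix.toEuclideanLin A (p.1 i))).re)
    (h := fun p => (z * ∑ i, inner ℂ (p.2 i) (Matrix.toEuclideanLin B (p.1 i))).re)
    (continuous_const.sub (Complex.continuous_re.comp (by fun_prop)))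
    (Complex.continuous_re.comp (by fun_prop))
    (fun p hp => sub_nonneg.mpr (re_sum_inner_le_kyFanNorm hkn A hp.1 hp.2)) (by
      intro t _
      obtain ⟨u, v, hu, hv, huv⟩ := exists_re_sum_inner_eq_kyFanNorm hkn (A + (-(t * z)) • B)
      refine ⟨(u, v), ⟨hu, hv⟩, ?_⟩
      -- Orthogonality bounds the norm of `A` by the value of the perturbed form at its own
      -- maximiser `(u, v)`, which is exactly `g + t h ≤ 0`.
      have h1 := h (-(t * z))
      rw [← huv] at h1
      simp only [map_add, map_smul, LinearMap.add_apply, LinearMap.smul_apply, inner_add_right,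
        inner_smul_right, Finset.sum_add_distrib, ← Finset.mul_sum] at h1
      rw [neg_mul, mul_assoc, Complex.add_re, Complex.neg_re, Complex.re_ofReal_mul] at h1
      simp only
      linarith)
  exact ⟨u, v, hu, hv, (sub_eq_zero.mp h1).symm, h2⟩

/-- The necessary condition for orthogonality. -/
theorem IsPolarDecomposition.exists_of_bjOrthogonal {k : ℕ} (hkn : k ≤ n)
    {A B U : Matrix (Fin n) (Fin n) ℂ} (hU : IsPolarDecomposition A U)
    (hpos : 0 < singVal A (k - 1)) (h : BJOrthogonal (kyFanNorm k) A B) :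
    ∃ u : Fin k → EuclideanSpace ℂ (Fin n), Orthonormal ℂ u ∧
      (∀ i, Matrix.toEuclideanLin (CFC.abs A) (u i) = (singVal A i : ℂ) • u i) ∧
      ∑ i, inner ℂ (u i) (Matrix.toEuclideanLin (U.conjTranspose * B) (u i)) = 0 := by
  obtain ⟨e, f, hA, hP, hUe⟩ := hU.exists_basis
  have hs := singVal_antitone A
  have hs0 := singVal_nonneg A
  have hdiag := re_sum_inner_eq_of_singular_bases (k := k) e e _ hP
  have hdiag' : ∀ u : Fin k → EuclideanSpace ℂ (Fin n),
      (∑ i, inner ℂ (u i) (Matrix.toEuclideanLin (CFC.abs A) (u i))).re =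
      ∑ j : Fin n, singVal A j * ∑ i, ‖inner ℂ (e j) (u i)‖ ^ 2 := by
    intro u
    rw [hdiag u u]
    simp
  set T := Matrix.toEuclideanLin (U.conjTranspose * B) with hT
  set S := {u : Fin k → EuclideanSpace ℂ (Fin n) | Orthonormal ℂ u ∧
    (∑ i, inner ℂ (u i) (Matrix.toEuclideanLin (CFC.abs A) (u i))).re = kyFanNorm k A} with hS
  have hcont : ∀ T : EuclideanSpace ℂ (Fin n) →ₗ[ℂ] EuclideanSpace ℂ (Fin n), Continuous T :=
    fun T => T.continuous_of_finiteDimensional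
  have hTc := hcont T
  have hPc := hcont (Matrix.toEuclideanLin (CFC.abs A))
  have hScompact : IsCompact S := (isCompact_setOf_orthonormal k).inter_right
    (isClosed_eq (Complex.continuous_re.comp (by fun_prop)) continuous_const)
  have hzero := Complex.zero_mem_of_forall_exists_re_nonpos
    (convex_image_sum_inner (Matrix.toEuclideanLin (CFC.abs A)) T (kyFanNorm k A) fun w hw =>
      re_sum_inner_le hkn hs hs0 e e _ hP hw hw)
    (hScompact.image (by fun_prop)) (by
      intro z
      obtain ⟨u, v, hu, hv, huv, hz⟩ := h.exists_re_sum_inner_nonpos hkn z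
      obtain ⟨h1, h2⟩ := of_re_sum_inner_eq hkn hs hs0 hpos e f _ hA hu hv huv
      refine ⟨_, ⟨u, ⟨hu, (hdiag' u).trans h1⟩, rfl⟩, ?_⟩
      -- The coefficients of `v i` in `f` equal those of `u i` in `e`, and `U` sends `e j` to `f j`.
      have hvu : ∀ i, v i = Matrix.toEuclideanLin U (u i) := by
        intro i
        rw [← f.sum_repr' (v i), ← e.sum_repr' (u i), map_sum]
        refine Finset.sum_congr rfl fun j _ => ?_
        rw [map_smul, hUe, ← h2 i j]
      simp only [hT, Matrix.toEuclideanLin_mul_apply, Matrix.inner_toEuclideanLin_conjTranspose]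
      simpa only [hvu] using hz)
  obtain ⟨u, ⟨hu, huN⟩, hu0⟩ := hzero
  obtain ⟨w, hw, hwP, hwT⟩ := hu.exists_eigenvectors_of_sum_diagonal_eq hkn hs e _ hP
    ((hdiag' u).symm.trans huN)
  exact ⟨w, hw, hwP, (hwT T).trans hu0⟩

end Matrix

theorem theorem1 (n k : ℕ) (hk : 1 ≤ k) (hkn : k ≤ n)
    (A B U : Matrix (Fin n) (Fin n) ℂ) (hU : IsPolarDecomposition A U) :
    ((∃ u : Fin k → EuclideanSpace ℂ (Fin n), Orthonormal ℂ u ∧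
        (∀ i, Matrix.toEuclideanLin (CFC.abs A) (u i) = (singVal A i : ℂ) • u i) ∧
        ∑ i, inner ℂ (u i) (Matrix.toEuclideanLin (U.conjTranspose * B) (u i)) = 0) →
      BJOrthogonal (kyFanNorm k) A B) ∧
    (0 < singVal A (k - 1) → BJOrthogonal (kyFanNorm k) A B →
      ∃ u : Fin k → EuclideanSpace ℂ (Fin n), Orthonormal ℂ u ∧
        (∀ i, Matrix.toEuclideanLin (CFC.abs A) (u i) = (singVal A i : ℂ) • u i) ∧
        ∑ i, inner ℂ (u i) (Matrix.toEuclideanLin (U.conjTranspose * B) (u i)) = 0) := by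
  exact ⟨fun ⟨_, hu, hA, hB⟩ => hU.bjOrthogonal hkn hu hA hB,
    fun hpos h => hU.exists_of_bjOrthogonal hkn hpos h⟩
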